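/- Let $\mathcal X,\mathcal Y$ be finite sets of inputs and $\mathcal A,\mathcal B$ finite nonempty sets of outcomes, $A=|\mathcal A|$, $B=|\mathcal B|$. A family $\mathbf p=(p(a,b|x,y))$ is a \emph{quantum distribution} if there are a complex Hilbert space $\mathcal H$ (of any dimension), a unit vector $\psi\in\mathcal H$, and for every $x\in\mathcal X$ and every $y\in\mathcal Y$ bounded self-adjoint operators $(E_a(x))_{a\in\mathcal A}$ and $(F_b(y))_{b\in\mathcal B}$ on $\mathcal H$ with $E_a(x)E_{a'}(x)=\delta_{aa'}E_a(x)$, $F_b(y)F_{b'}(y)=\delta_{bb'}F_b(y)$, $\sum_aE_a(x)=\mathbb 1=\sum_bF_b(y)$ and $E_a(x)F_b(y)=F_b(y)E_a(x)$, such that $p(a,b|x,y)=\langle\psi,E_a(x)F_b(y)\psi\rangle$ for all $a,b,x,y$. A \emph{local distribution} is a convex combination of families of the form $\delta_{a=f(x)}\,\delta_{b=g(y)}$ with $f:\mathcal X\to\mathcal A$ and $g:\mathcal Y\to\mathcal B$; let $\mathcal L$ be the set of local distributions. Put $$\tilde\nu(\mathbf p)=\min\Big\{\sum_i|q_i| \;:\;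 \mathbf p=\sum_iq_i\mathbf p_i \text{ a finite sum with } \mathbf p_i\in\mathcal L,\ q_i\in\mathbb R\Big\}.$$ Let $K_G$ be the (real) Grothendieck constant: the least $K$ such that, for every real $m\times n$ matrix $M$ with $\big|\sum_{i,j}M_{ij}s_it_j\big|\le1$ for all signs $s_i,t_j\in\{\pm1\}$, one has $\big|\sum_{i,j}M_{ij}\langle u_i,v_j\rangle\big|\le K$ for all unit vectors $u_i,v_j$ in a Euclidean space $\mathbb R^d$ of any dimension. Then for every quantum distribution $\mathbf p$ the minimum defining $\tilde\nu(\mathbf p)$ exists, and 1. $\tilde\nu(\mathbf p)\le 2K_G+1$ when $A=B=2$; 2. $\tilde\nu(\mathbf p)\le 2AB(K_G+1)-1$ for any $A,B$. Consequently, every linear functional $\beta(\mathbf p)=\sum_{a,b,x,y}\beta_{abxy}\,p(a,b|x,y)$ that is normalized, in the sense that $|\beta(\mathbf p')|\le1$ for all $\mathbf p'\in\mathcal L$, satisfies on every quantum distribution $\mathbf p$ the same bounds: $\beta(\mathbf p)\le 2K_G+1$ when $A=B=2$, and $\beta(\mathbf p)\le 2AB(K_G+1)-1$ in general. -/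

import Mathlib

universe w

namespace BellScenario

/-- A table `p x y a b` of real numbers, read as `p(a, b | x, y)`: inputs `x, y`, outcomes `a, b`. -/
abbrev Table (X Y A B : Type*) := X → Y → A → B → ℝ

open Classical in
/-- The local deterministic distribution `p(a, b | x, y) = δ_{a = f(x)} δ_{b = g(y)}`. -/
noncomputable def localDeterministic {X Y A B : Type*} (f : X → A) (g : Y → B) :
    Table X Y A B :=
  fun x y a b => (if a = f x then 1 else 0) * (if b = g y then 1 else 0)

/-- The set of local distributions: the convex combinations of local deterministic ones. -/
def localDistributions (X Y A B : Type*) : Set (Table X Y A B) :=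
  convexHull ℝ {p | ∃ (f : X → A) (g : Y → B), p = localDeterministic f g}

/-- A projective measurement with outcomes in `A` on the Hilbert space `H`: self-adjoint,
mutually orthogonal projections summing to the identity. -/
structure IsProjectiveMeasurement {H A : Type*} [NormedAddCommGroup H] [InnerProductSpace ℂ H]
    [CompleteSpace H] [Fintype A] (E : A → H →L[ℂ] H) : Prop where
  selfAdjoint : ∀ a, IsSelfAdjoint (E a)
  idempotent : ∀ a, E a * E a = E a
  orthogonal : ∀ a a', a ≠ a' → E a * E a' = 0
  sum_eq_one : ∑ a, E a = 1

/-- Quantum distributions: `p(a, b | x, y) = ⟨ψ, E_a(x) F_b(y) ψ⟩` for a unit vector `ψ` of a complex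
Hilbert space (of any dimension) and projective measurements of the two parties that commute. -/
def IsQuantum {X Y A B : Type*} [Fintype A] [Fintype B] (p : Table X Y A B) : Prop :=
  ∃ (H : Type w) (_ : NormedAddCommGroup H) (_ : InnerProductSpace ℂ H) (_ : CompleteSpace H)
    (ψ : H) (E : X → A → H →L[ℂ] H) (F : Y → B → H →L[ℂ] H),
    ‖ψ‖ = 1 ∧
    (∀ x, IsProjectiveMeasurement (E x)) ∧
    (∀ y, IsProjectiveMeasurement (F y)) ∧
    (∀ x y a b, E x a * F y b = F y b * E x a) ∧
    ∀ x y a b, (p x y a b : ℂ) = inner ℂ ψ ((E x a * F y b) ψ)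

/-- The costs `∑ i, |q i|` of all the ways of writing `p = ∑ i, q i • P i` as a finite real
combination of local distributions `P i`. -/
def affineModelCosts {X Y A B : Type*} (p : Table X Y A B) : Set ℝ :=
  {c | ∃ (n : ℕ) (q : Fin n → ℝ) (P : Fin n → Table X Y A B),
    (∀ i, P i ∈ localDistributions X Y A B) ∧ p = ∑ i, q i • P i ∧ c = ∑ i, |q i|}

/-- `ν̃(p)`, the least cost of a model of `p` by local distributions. -/
noncomputable def nuTilde {X Y A B : Type*} (p : Table X Y A B) : ℝ :=
  sInf (affineModelCosts p)

/-- The value `∑ β_{abxy} p(a, b | x, y)` at `p` of the linear functional with coefficients `β`. -/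
def bellValue {X Y A B : Type*} [Fintype X] [Fintype Y] [Fintype A] [Fintype B]
    (β p : Table X Y A B) : ℝ :=
  ∑ x, ∑ y, ∑ a, ∑ b, β x y a b * p x y a b

/-- `β` is a normalized Bell functional: it is bounded by `1` in absolute value on all local
distributions. -/
def IsNormalizedBell {X Y A B : Type*} [Fintype X] [Fintype Y] [Fintype A] [Fintype B]
    (β : Table X Y A B) : Prop :=
  ∀ p ∈ localDistributions X Y A B, |bellValue β p| ≤ 1

/-- `K` is admissible in the (real) Grothendieck inequality. -/
def IsGrothendieckBound (K : ℝ) : Prop :=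
  ∀ (m n : ℕ) (M : Matrix (Fin m) (Fin n) ℝ),
    (∀ (s : Fin m → ℝ) (t : Fin n → ℝ), (∀ i, s i = 1 ∨ s i = -1) → (∀ j, t j = 1 ∨ t j = -1) →
      |∑ i, ∑ j, M i j * s i * t j| ≤ 1) →
    ∀ (d : ℕ) (u : Fin m → EuclideanSpace ℝ (Fin d)) (v : Fin n → EuclideanSpace ℝ (Fin d)),
      (∀ i, ‖u i‖ = 1) → (∀ j, ‖v j‖ = 1) →
      |∑ i, ∑ j, M i j * inner ℝ (u i) (v j)| ≤ K

/-- Grothendieck's constant `K_G` (real case): the least constant in Grothendieck's inequality. -/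
noncomputable def grothendieckConstant : ℝ :=
  sInf {K | IsGrothendieckBound K}

end BellScenario

-- By linear programming duality, `nuTilde p` is at most any positive `c` bounding all normalized
-- Bell functionals at `p`, so everything reduces to `IsQuantum.bellValue_le`. Let `P` be the
-- product of the two marginals of `p`. It is local, hence worth at most 1, and `D = p - P` has zero
-- marginals. With reference outcomes `a₀`, `b₀`, `D` is then a sum of correlation tables over pairs
-- `(a, b)`, of which only the `(A - 1)(B - 1)` pairs avoiding `a₀` and `b₀` contribute. For one
-- pair, `4 D` equals `⟨u x, v y⟩ - r x * s y`, where `u x = (2 E_a(x) - 1)ψ` and `v y = (2 F_b(y) -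
-- 1)ψ` are unit vectors and `r`, `s` are the biases of the marginals. A normalized functional
-- restricted to such tables is 4 times a matrix bounded by 1 on signs, so Grothendieck's inequality
-- bounds the pair by `K_G + 1`. The total `1 + (A - 1)(B - 1)(K_G + 1)` implies both stated bounds
-- because `K_G ≥ 1`.

namespace BellScenario

-- Grothendieck's inequality with some finite constant, and `1 ≤ K_G`.

section Grothendieck

/-- The Rademacher sum `∑ k, ± u k` with signs given by `ω`. -/
def rademacherSum {d : ℕ} (u : Fin d → ℝ) (ω : Fin d → Bool) : ℝ :=
  ∑ k, u k * (if ω k then 1 else -1)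

theorem sum_bool_cons {d : ℕ} (F : (Fin (d + 1) → Bool) → ℝ) :
    ∑ ω, F ω = ∑ ω : Fin d → Bool, (F (Fin.cons true ω) + F (Fin.cons false ω)) := by
  rw [← (Fin.consEquiv fun _ : Fin (d + 1) => Bool).sum_comp F, Fintype.sum_prod_type,
    Fintype.sum_bool, ← Finset.sum_add_distrib]
  rfl

theorem rademacherSum_cons {d : ℕ} (u : Fin (d + 1) → ℝ) (b : Bool) (ω : Fin d → Bool) :
    rademacherSum u (Fin.cons b ω : Fin (d + 1) → Bool) =
      u 0 * (if b then 1 else -1) + rademacherSum (fun k => u k.succ) ω := by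
  simp [rademacherSum, Fin.sum_univ_succ]

/-- Orthogonality of the signs: up to the factor `2 ^ d`, the map to Rademacher sums is an isometry,
so vectors may be replaced by functions. -/
theorem sum_rademacherSum_mul {d : ℕ} (u v : Fin d → ℝ) :
    ∑ ω, rademacherSum u ω * rademacherSum v ω = 2 ^ d * ∑ k, u k * v k := by
  induction d with
  | zero => simp [rademacherSum]
  | succ d ih =>
    rw [sum_bool_cons, Fin.sum_univ_succ, pow_succ, mul_add,
      show (2 : ℝ) ^ d * 2 * ∑ k : Fin d, u k.succ * v k.succ
        = 2 * (2 ^ d * ∑ k : Fin d, u k.succ * v k.succ) by ring, ← ih, Finset.mul_sum]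
    have h : (2 : ℝ) ^ d * 2 * (u 0 * v 0) = ∑ _ω : Fin d → Bool, 2 * (u 0 * v 0) := by
      simp; ring
    rw [h, ← Finset.sum_add_distrib]
    refine Finset.sum_congr rfl fun ω _ => ?_
    simp only [rademacherSum_cons]
    simp
    ring

/-- Khinchin's inequality for the fourth moment; it controls the tails cut off by `truncEight`. -/
theorem sum_rademacherSum_pow_four_le {d : ℕ} (u : Fin d → ℝ) :
    ∑ ω, rademacherSum u ω ^ 4 ≤ 2 ^ d * (3 * (∑ k, u k ^ 2) ^ 2) := by
  induction d with
  | zero => simp [rademacherSum]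
  | succ d ih =>
    have h2 := sum_rademacherSum_mul (fun k => u k.succ) (fun k => u k.succ)
    have h4 := ih fun k => u k.succ
    simp only [← pow_two] at h2
    have key : ∑ ω, rademacherSum u ω ^ 4 =
        2 * (∑ ω, rademacherSum (fun k => u k.succ) ω ^ 4) +
        12 * u 0 ^ 2 * (∑ ω, rademacherSum (fun k => u k.succ) ω ^ 2) + 2 ^ d * (2 * u 0 ^ 4) := by
      have h : (2 : ℝ) ^ d * (2 * u 0 ^ 4) = ∑ _ω : Fin d → Bool, 2 * u 0 ^ 4 := by simp
      rw [sum_bool_cons, h, Finset.mul_sum, Finset.mul_sum, ← Finset.sum_add_distrib,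
        ← Finset.sum_add_distrib]
      refine Finset.sum_congr rfl fun ω _ => ?_
      simp only [rademacherSum_cons]
      simp
      ring
    rw [key, h2, Fin.sum_univ_succ]
    -- The slack in the induction: the first coordinate contributes `2 * u 0 ^ 4`, while the bound
    -- allows `6 * u 0 ^ 4`.
    have h0 : (0 : ℝ) ≤ 2 ^ d * u 0 ^ 4 := by positivity
    generalize ∑ k : Fin d, u k.succ ^ 2 = s at h4 ⊢
    rw [pow_succ]
    linear_combination 2 * h4 + 4 * h0

theorem exists_sign (r : ℝ) : ∃ s : ℝ, (s = 1 ∨ s = -1) ∧ s * r = |r| := by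
  rcases le_total 0 r with h | h
  · exact ⟨1, .inl rfl, by rw [abs_of_nonneg h, one_mul]⟩
  · exact ⟨-1, .inr rfl, by rw [abs_of_nonpos h, neg_one_mul]⟩

theorem abs_sum_mul_le_of_signs {I : Type*} [Fintype I] {c : I → ℝ} {K : ℝ}
    (h : ∀ s : I → ℝ, (∀ i, s i = 1 ∨ s i = -1) → |∑ i, s i * c i| ≤ K)
    (s : I → ℝ) (hs : ∀ i, |s i| ≤ 1) : |∑ i, s i * c i| ≤ K := by
  choose σ hσ hσc using fun i => exists_sign (c i)
  calc |∑ i, s i * c i| ≤ ∑ i, |s i * c i| := Finset.abs_sum_le_sum_abs _ _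
    _ ≤ ∑ i, σ i * c i := Finset.sum_le_sum fun i _ => by
        rw [abs_mul, hσc]; exact mul_le_of_le_one_left (abs_nonneg _) (hs i)
    _ ≤ K := (le_abs_self _).trans (h σ hσ)

variable {I J : Type*} [Fintype I] [Fintype J]

/-- A bilinear form bounded by `1` at all signs is bounded by `1` on the unit cubes. -/
theorem abs_bilin_le_one_of_signs {M : I → J → ℝ}
    (hM : ∀ (s : I → ℝ) (t : J → ℝ), (∀ i, s i = 1 ∨ s i = -1) → (∀ j, t j = 1 ∨ t j = -1) →
      |∑ i, ∑ j, M i j * s i * t j| ≤ 1)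
    (s : I → ℝ) (t : J → ℝ) (hs : ∀ i, |s i| ≤ 1) (ht : ∀ j, |t j| ≤ 1) :
    |∑ i, ∑ j, M i j * s i * t j| ≤ 1 := by
  have e1 : ∀ (s : I → ℝ) (t : J → ℝ),
      ∑ i, ∑ j, M i j * s i * t j = ∑ i, s i * ∑ j, M i j * t j := fun s t =>
    Finset.sum_congr rfl fun i _ => by
      rw [Finset.mul_sum]; exact Finset.sum_congr rfl fun j _ => by ring
  have e2 : ∀ (s : I → ℝ) (t : J → ℝ),
      ∑ i, ∑ j, M i j * s i * t j = ∑ j, t j * ∑ i, M i j * s i := fun s t => by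
    rw [Finset.sum_comm]
    exact Finset.sum_congr rfl fun j _ => by
      rw [Finset.mul_sum]; exact Finset.sum_congr rfl fun i _ => by ring
  rw [e2]
  refine abs_sum_mul_le_of_signs (fun t ht => ?_) t ht
  rw [← e2, e1]
  refine abs_sum_mul_le_of_signs (fun s hs => ?_) s hs
  rw [← e1]
  exact hM s t hs ht

/-- The bilinear form `∑ M i j ⟨u i, v j⟩` for vectors in `ℝ^Ω`. -/
def gramForm (M : I → J → ℝ) {Ω : Type*} [Fintype Ω] (u : I → Ω → ℝ) (v : J → Ω → ℝ) : ℝ :=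
  ∑ i, ∑ j, M i j * ∑ ω, u i ω * v j ω

theorem gramForm_eq_sum (M : I → J → ℝ) {Ω : Type*} [Fintype Ω] (u : I → Ω → ℝ)
    (v : J → Ω → ℝ) : gramForm M u v = ∑ ω, ∑ i, ∑ j, M i j * u i ω * v j ω := by
  rw [Finset.sum_comm]
  refine Finset.sum_congr rfl fun i _ => ?_
  rw [Finset.sum_comm]
  refine Finset.sum_congr rfl fun j _ => ?_
  rw [Finset.mul_sum]
  exact Finset.sum_congr rfl fun ω _ => by ring

theorem gramForm_add_left (M : I → J → ℝ) {Ω : Type*} [Fintype Ω] (u u' : I → Ω → ℝ)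
    (v : J → Ω → ℝ) : gramForm M (u + u') v = gramForm M u v + gramForm M u' v := by
  simp only [gramForm_eq_sum, ← Finset.sum_add_distrib]
  exact Finset.sum_congr rfl fun ω _ => Finset.sum_congr rfl fun i _ =>
    Finset.sum_congr rfl fun j _ => by simp only [Pi.add_apply]; ring

theorem gramForm_add_right (M : I → J → ℝ) {Ω : Type*} [Fintype Ω] (u : I → Ω → ℝ)
    (v v' : J → Ω → ℝ) : gramForm M u (v + v') = gramForm M u v + gramForm M u v' := by
  simp only [gramForm_eq_sum, ← Finset.sum_add_distrib]
  exact Finset.sum_congr rfl fun ω _ => Finset.sum_congr rfl fun i _ =>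
    Finset.sum_congr rfl fun j _ => by simp only [Pi.add_apply]; ring

theorem gramForm_smul_smul (M : I → J → ℝ) {Ω : Type*} [Fintype Ω] (a b : ℝ) (u : I → Ω → ℝ)
    (v : J → Ω → ℝ) : gramForm M (a • u) (b • v) = a * b * gramForm M u v := by
  simp only [gramForm_eq_sum, Finset.mul_sum]
  exact Finset.sum_congr rfl fun ω _ => Finset.sum_congr rfl fun i _ =>
    Finset.sum_congr rfl fun j _ => by simp only [Pi.smul_apply, smul_eq_mul]; ring

/-- The values of `gramForm M` at vectors of norm at most `1`. -/
def gramValues (M : I → J → ℝ) : Set ℝ :=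
  {r | ∃ (d : ℕ) (u : I → Fin d → ℝ) (v : J → Fin d → ℝ),
    (∀ i, ∑ k, u i k ^ 2 ≤ 1) ∧ (∀ j, ∑ k, v j k ^ 2 ≤ 1) ∧ r = |gramForm M u v|}

theorem bddAbove_gramValues (M : I → J → ℝ) : BddAbove (gramValues M) := by
  refine ⟨∑ i, ∑ j, |M i j|, ?_⟩
  rintro _ ⟨d, u, v, hu, hv, rfl⟩
  refine (Finset.abs_sum_le_sum_abs _ _).trans (Finset.sum_le_sum fun i _ =>
    (Finset.abs_sum_le_sum_abs _ _).trans (Finset.sum_le_sum fun j _ => ?_))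
  rw [abs_mul]
  refine mul_le_of_le_one_right (abs_nonneg _) ?_
  have h := Finset.sum_mul_sq_le_sq_mul_sq Finset.univ (u i) (v j)
  rw [← sq_le_one_iff_abs_le_one]
  exact h.trans (mul_le_one₀ (hu i) (Finset.sum_nonneg fun _ _ => sq_nonneg _) (hv j))

theorem abs_gramForm_le_sSup (M : I → J → ℝ) {Ω : Type*} [Fintype Ω] (u : I → Ω → ℝ)
    (v : J → Ω → ℝ) (hu : ∀ i, ∑ k, u i k ^ 2 ≤ 1) (hv : ∀ j, ∑ k, v j k ^ 2 ≤ 1) :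
    |gramForm M u v| ≤ sSup (gramValues M) := by
  let e := (Fintype.equivFin Ω).symm
  refine le_csSup (bddAbove_gramValues M)
    ⟨_, fun i k => u i (e k), fun j k => v j (e k), fun i => ?_, fun j => ?_, ?_⟩
  · rw [e.sum_comp fun ω => u i ω ^ 2]; exact hu i
  · rw [e.sum_comp fun ω => v j ω ^ 2]; exact hv j
  · simp only [gramForm]
    congr 1
    exact Finset.sum_congr rfl fun i _ => Finset.sum_congr rfl fun j _ => by
      rw [e.sum_comp fun ω => u i ω * v j ω]

theorem abs_gramForm_le_mul_sSup (M : I → J → ℝ) {Ω : Type*} [Fintype Ω] (u : I → Ω → ℝ)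
    (v : J → Ω → ℝ) {a b : ℝ} (ha : 0 < a) (hb : 0 < b)
    (hu : ∀ i, ∑ k, u i k ^ 2 ≤ a ^ 2) (hv : ∀ j, ∑ k, v j k ^ 2 ≤ b ^ 2) :
    |gramForm M u v| ≤ a * b * sSup (gramValues M) := by
  have key : ∀ {c : ℝ} (_ : 0 < c) (w : Ω → ℝ), ∑ k, w k ^ 2 ≤ c ^ 2 →
      ∑ k, (c⁻¹ • w) k ^ 2 ≤ 1 := by
    intro c hc w hw
    simp only [Pi.smul_apply, smul_eq_mul, mul_pow, ← Finset.mul_sum]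
    rw [inv_pow, inv_mul_le_iff₀ (by positivity), mul_one]
    exact hw
  have h := abs_gramForm_le_sSup M (a⁻¹ • u) (b⁻¹ • v) (fun i => key ha _ (hu i))
    fun j => key hb _ (hv j)
  rw [gramForm_smul_smul, abs_mul, abs_of_pos (by positivity), ← mul_inv,
    inv_mul_le_iff₀ (by positivity)] at h
  exact h

/-- The part of `x` bounded by `8`. -/
noncomputable def truncEight (x : ℝ) : ℝ := if |x| ≤ 8 then x else 0

theorem abs_truncEight_le (x : ℝ) : |truncEight x| ≤ 8 := by
  unfold truncEight; split_ifs with h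
  · exact h
  · simp

theorem truncEight_sq_le (x : ℝ) : truncEight x ^ 2 ≤ x ^ 2 := by
  unfold truncEight; split_ifs with h
  · rfl
  · simp [sq_nonneg]

theorem sub_truncEight_sq_le (x : ℝ) : 64 * (x - truncEight x) ^ 2 ≤ x ^ 4 := by
  unfold truncEight; split_ifs with h
  · simp; positivity
  · have h1 : 8 ^ 2 ≤ |x| ^ 2 := by gcongr; exact (not_le.1 h).le
    rw [sq_abs] at h1
    nlinarith [sq_nonneg x]

/-- **Grothendieck's inequality**, with constant `128`. -/
theorem abs_gramForm_le {M : I → J → ℝ}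
    (hM : ∀ (s : I → ℝ) (t : J → ℝ), (∀ i, s i = 1 ∨ s i = -1) → (∀ j, t j = 1 ∨ t j = -1) →
      |∑ i, ∑ j, M i j * s i * t j| ≤ 1) {Ω : Type*} [Fintype Ω] (u : I → Ω → ℝ)
    (v : J → Ω → ℝ) (hu : ∀ i, ∑ k, u i k ^ 2 ≤ 1) (hv : ∀ j, ∑ k, v j k ^ 2 ≤ 1) :
    |gramForm M u v| ≤ 128 := by
  refine (abs_gramForm_le_sSup M u v hu hv).trans ?_
  -- Self-improvement: the tails are again vectors, of small norm, so the supremum itself bounds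
  -- their contribution.
  suffices h : sSup (gramValues M) ≤ 64 + sSup (gramValues M) / 2 by linarith
  refine csSup_le ⟨_, 0, 0, 0, by simp, by simp, rfl⟩ ?_
  rintro _ ⟨d, u, v, hu, hv, rfl⟩
  set S := sSup (gramValues M)
  let x : I → (Fin d → Bool) → ℝ := fun i => rademacherSum (u i)
  let y : J → (Fin d → Bool) → ℝ := fun j => rademacherSum (v j)
  let x₀ : I → (Fin d → Bool) → ℝ := fun i ω => truncEight (x i ω)
  let y₀ : J → (Fin d → Bool) → ℝ := fun j ω => truncEight (y j ω)
  obtain ⟨N, hN, hN2⟩ : ∃ N : ℝ, 0 < N ∧ N ^ 2 = 2 ^ d :=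
    ⟨√(2 ^ d), by positivity, Real.sq_sqrt (by positivity)⟩
  have norm_le : ∀ w : Fin d → ℝ, ∑ k, w k ^ 2 ≤ 1 → ∑ ω, rademacherSum w ω ^ 2 ≤ N ^ 2 := by
    intro w hw
    have := sum_rademacherSum_mul w w
    simp only [← pow_two] at this
    rw [this, hN2]
    exact mul_le_of_le_one_right (by positivity) hw
  have tail_le : ∀ w : Fin d → ℝ, ∑ k, w k ^ 2 ≤ 1 →
      ∑ ω, (rademacherSum w ω - truncEight (rademacherSum w ω)) ^ 2 ≤ (N / 4) ^ 2 := by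
    intro w hw
    have h1 : 64 * ∑ ω, (rademacherSum w ω - truncEight (rademacherSum w ω)) ^ 2 ≤
        ∑ ω, rademacherSum w ω ^ 4 := by
      rw [Finset.mul_sum]; exact Finset.sum_le_sum fun ω _ => sub_truncEight_sq_le _
    have h2 := sum_rademacherSum_pow_four_le w
    have h3 : (∑ k, w k ^ 2) ^ 2 ≤ 1 :=
      pow_le_one₀ (Finset.sum_nonneg fun _ _ => sq_nonneg _) hw
    rw [← hN2] at h2
    -- The tail has squared norm at most `3 N² / 64 ≤ (N / 4)²`; the cutoff 8 makes the two error
    -- terms add up to `N² S / 2`.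
    nlinarith [sq_nonneg N]
  have hxy : gramForm M x y = N ^ 2 * gramForm M u v := by
    simp only [gramForm, x, y, sum_rademacherSum_mul, hN2, Finset.mul_sum]
    exact Finset.sum_congr rfl fun i _ => Finset.sum_congr rfl fun j _ =>
      Finset.sum_congr rfl fun k _ => by ring
  have hsplit : gramForm M x y =
      gramForm M x₀ y₀ + gramForm M x₀ (y - y₀) + gramForm M (x - x₀) y := by
    rw [← gramForm_add_right, add_sub_cancel, ← gramForm_add_left, add_sub_cancel]
  -- At each of the `2 ^ d = N ^ 2` points, dividing by 8 puts both arguments in the unit cube, at a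
  -- cost of `8 * 8`.
  have b1 : |gramForm M x₀ y₀| ≤ 64 * N ^ 2 := by
    rw [gramForm_eq_sum]
    refine (Finset.abs_sum_le_sum_abs _ _).trans ?_
    have : ∀ ω ∈ Finset.univ, |∑ i, ∑ j, M i j * x₀ i ω * y₀ j ω| ≤ 64 := by
      intro ω _
      have h := abs_bilin_le_one_of_signs hM (fun i => x₀ i ω / 8) (fun j => y₀ j ω / 8)
        (fun i => by
          rw [abs_div, abs_of_pos (by norm_num : (0 : ℝ) < 8)]
          have := abs_truncEight_le (x i ω)
          simp only [x₀]; linarith)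
        (fun j => by
          rw [abs_div, abs_of_pos (by norm_num : (0 : ℝ) < 8)]
          have := abs_truncEight_le (y j ω)
          simp only [y₀]; linarith)
      have e : ∑ i, ∑ j, M i j * x₀ i ω * y₀ j ω =
          64 * ∑ i, ∑ j, M i j * (x₀ i ω / 8) * (y₀ j ω / 8) := by
        simp only [Finset.mul_sum]
        exact Finset.sum_congr rfl fun i _ => Finset.sum_congr rfl fun j _ => by ring
      rw [e, abs_mul, abs_of_pos (by norm_num : (0 : ℝ) < 64)]
      linarith
    refine (Finset.sum_le_card_nsmul _ _ _ this).trans_eq ?_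
    simp [hN2, mul_comm]
  have b2 : |gramForm M x₀ (y - y₀)| ≤ N * (N / 4) * S :=
    abs_gramForm_le_mul_sSup M _ _ hN (by positivity)
      (fun i => (Finset.sum_le_sum fun ω _ => truncEight_sq_le _).trans (norm_le _ (hu i)))
      fun j => tail_le _ (hv j)
  have b3 : |gramForm M (x - x₀) y| ≤ N / 4 * N * S :=
    abs_gramForm_le_mul_sSup M _ _ (by positivity) hN (fun i => tail_le _ (hu i))
      fun j => norm_le _ (hv j)
  have hfin : N ^ 2 * |gramForm M u v| ≤ N ^ 2 * (64 + S / 2) := by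
    rw [← abs_of_pos (by positivity : 0 < N ^ 2), ← abs_mul, ← hxy, hsplit,
      abs_of_pos (by positivity : 0 < N ^ 2)]
    have := abs_add_three (gramForm M x₀ y₀) (gramForm M x₀ (y - y₀)) (gramForm M (x - x₀) y)
    nlinarith
  exact le_of_mul_le_mul_left hfin (by positivity)

/-- Only finiteness matters: it rules out the default value 0 of `sInf` on the empty set. -/
theorem isGrothendieckBound_128 : IsGrothendieckBound 128 := by
  intro m n M hM d u v hu hv
  have h := abs_gramForm_le hM (fun i k => u i k) (fun j k => v j k)
    (fun i => by rw [← EuclideanSpace.real_norm_sq_eq, hu]; norm_num)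
    fun j => by rw [← EuclideanSpace.real_norm_sq_eq, hv]; norm_num
  simpa [gramForm, PiLp.inner_apply, mul_comm] using h

theorem isGrothendieckBound_grothendieckConstant : IsGrothendieckBound grothendieckConstant :=
  fun m n M hM d u v hu hv =>
    le_csInf ⟨_, isGrothendieckBound_128⟩ fun _ hK => hK m n M hM d u v hu hv

theorem one_le_grothendieckConstant : 1 ≤ grothendieckConstant := by
  refine le_csInf ⟨_, isGrothendieckBound_128⟩ fun K hK => ?_
  have h := hK 1 1 (fun _ _ => 1) (fun s t hs ht => by
    rcases hs 0 with h | h <;> rcases ht 0 with h' | h' <;> simp [h, h']) 1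
    (fun _ => EuclideanSpace.single 0 1) (fun _ => EuclideanSpace.single 0 1)
    (fun _ => by simp) fun _ => by simp
  simpa using h

end Grothendieck

-- Product distributions, correlation tables and Bell values.

section Local

variable {X Y A B : Type*}

/-- The product of the families `α x a` and `γ y b`. -/
def productTable (α : X → A → ℝ) (γ : Y → B → ℝ) : Table X Y A B := fun x y a b => α x a * γ y b

theorem productTable_sub_left (α α' : X → A → ℝ) (γ : Y → B → ℝ) :
    productTable (α - α') γ = productTable α γ - productTable α' γ := by
  ext x y a b; simp [productTable, sub_mul]

theorem productTable_sub_right (α : X → A → ℝ) (γ γ' : Y → B → ℝ) :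
    productTable α (γ - γ') = productTable α γ - productTable α γ' := by
  ext x y a b; simp [productTable, mul_sub]

open Classical in
/-- A family of probability vectors is a convex combination of deterministic ones. -/
theorem mem_convexHull_deterministic [Fintype X] [Fintype A] {α : X → A → ℝ}
    (hα : ∀ x, α x ∈ stdSimplex ℝ A) :
    α ∈ convexHull ℝ (Set.range fun (f : X → A) x a => if a = f x then (1 : ℝ) else 0) := by
  have h : α ∈ Set.univ.pi fun _ : X =>
      convexHull ℝ (Set.range fun a' a : A => if a = a' then (1 : ℝ) else 0) := by
    intro x _
    have := hα x
    rw [← convexHull_basis_eq_stdSimplex] at this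
    convert this using 5
    simp only [eq_comm]
  -- The convex hull of a product of sets is the product of their hulls.
  rw [← convexHull_pi] at h
  convert h using 1
  congr 1
  ext φ
  simp only [Set.mem_range, Set.mem_pi, Set.mem_univ, true_implies]
  constructor
  · rintro ⟨f, rfl⟩ x
    exact ⟨f x, rfl⟩
  · intro h
    choose f hf using h
    exact ⟨f, funext hf⟩

/-- The product is bilinear, so each factor can be reduced in turn to deterministic ones. -/
theorem productTable_mem_localDistributions [Fintype X] [Fintype Y] [Fintype A] [Fintype B]
    {α : X → A → ℝ} {γ : Y → B → ℝ} (hα : ∀ x, α x ∈ stdSimplex ℝ A)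
    (hγ : ∀ y, γ y ∈ stdSimplex ℝ B) : productTable α γ ∈ localDistributions X Y A B := by
  classical
  let L : (X → A → ℝ) →ₗ[ℝ] (Y → B → ℝ) →ₗ[ℝ] Table X Y A B :=
    LinearMap.mk₂ ℝ productTable
      (fun _ _ _ => by ext; simp [productTable, add_mul])
      (fun _ _ _ => by ext; simp [productTable, mul_assoc])
      (fun _ _ _ => by ext; simp [productTable, mul_add])
      (fun _ _ _ => by ext; simp [productTable, mul_left_comm])
  have hconv : Convex ℝ (localDistributions X Y A B) := convex_convexHull _ _
  refine (convexHull_min ?_ (hconv.linear_preimage (L.flip γ)))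
    (mem_convexHull_deterministic hα)
  rintro _ ⟨f, rfl⟩
  refine (convexHull_min ?_ (hconv.linear_preimage (L _))) (mem_convexHull_deterministic hγ)
  rintro _ ⟨g, rfl⟩
  refine subset_convexHull _ _ ⟨f, g, ?_⟩
  ext x y a b
  simp [L, productTable, localDeterministic]

open Classical in
/-- The probability vectors equal to `a` with probability `(1 + r) / 2` and to `a₀` otherwise. -/
noncomputable def twoPoint (a a₀ : A) (r : ℝ) : A → ℝ :=
  ((1 + r) / 2) • Pi.single a 1 + ((1 - r) / 2) • Pi.single a₀ 1

open Classical in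
theorem twoPoint_sub (a a₀ : A) (r : ℝ) :
    twoPoint a a₀ r - twoPoint a a₀ (-r) = r • (Pi.single a 1 - Pi.single a₀ 1) := by
  unfold twoPoint
  module

open Classical in
/-- The table equal to `c x y` times the tensor of `δ_a - δ_{a₀}` and `δ_b - δ_{b₀}`. -/
noncomputable def correlationTable (a a₀ : A) (b b₀ : B) (c : X → Y → ℝ) : Table X Y A B :=
  fun x y => c x y • fun a' b' =>
    (Pi.single a 1 - Pi.single a₀ 1 : A → ℝ) a' * (Pi.single b 1 - Pi.single b₀ 1 : B → ℝ) b'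

theorem correlationTable_self_left (a : A) (b b₀ : B) (c : X → Y → ℝ) :
    (correlationTable a a b b₀ c : Table X Y A B) = 0 := by
  ext; simp [correlationTable]

theorem correlationTable_self_right (a a₀ : A) (b : B) (c : X → Y → ℝ) :
    (correlationTable a a₀ b b c : Table X Y A B) = 0 := by
  ext; simp [correlationTable]

open Classical in
theorem twoPoint_mem_stdSimplex [Fintype A] (a a₀ : A) {r : ℝ} (hr : |r| ≤ 1) :
    twoPoint a a₀ r ∈ stdSimplex ℝ A := by
  have := abs_le.1 hr
  exact convex_stdSimplex ℝ A (single_mem_stdSimplex ℝ a) (single_mem_stdSimplex ℝ a₀)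
    (by linarith) (by linarith) (by ring)

theorem abs_two_mul_sub_one_le {C : Type*} [Fintype C] {μ : C → ℝ} (h : μ ∈ stdSimplex ℝ C)
    (c : C) : |2 * μ c - 1| ≤ 1 := by
  have := mem_Icc_of_mem_stdSimplex h c
  rw [abs_le]; constructor <;> linarith [this.1, this.2]

variable [Fintype X] [Fintype Y] [Fintype A] [Fintype B]

theorem bellValue_add (β p q : Table X Y A B) :
    bellValue β (p + q) = bellValue β p + bellValue β q := by
  simp [bellValue, mul_add, Finset.sum_add_distrib]

theorem bellValue_smul (β p : Table X Y A B) (c : ℝ) :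
    bellValue β (c • p) = c * bellValue β p := by
  simp [bellValue, Finset.mul_sum, mul_left_comm]

theorem bellValue_sub (β p q : Table X Y A B) :
    bellValue β (p - q) = bellValue β p - bellValue β q := by
  simp [bellValue, mul_sub, Finset.sum_sub_distrib]

theorem bellValue_correlationTable (β : Table X Y A B) (a a₀ : A) (b b₀ : B) (c : X → Y → ℝ) :
    bellValue β (correlationTable a a₀ b b₀ c) =
      ∑ x, ∑ y, (β x y a b - β x y a₀ b - β x y a b₀ + β x y a₀ b₀) * c x y := by
  classical
  refine Finset.sum_congr rfl fun x _ => Finset.sum_congr rfl fun y _ => ?_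
  have h : ∀ (φ : A → ℝ) (a : A), ∑ a', φ a' * (Pi.single a 1 : A → ℝ) a' = φ a := by
    intro φ a; simp [Pi.single_apply]
  have h' : ∀ (φ : B → ℝ) (b : B), ∑ b', φ b' * (Pi.single b 1 : B → ℝ) b' = φ b := by
    intro φ b; simp [Pi.single_apply]
  calc ∑ a', ∑ b', β x y a' b' * correlationTable a a₀ b b₀ c x y a' b'
      = c x y * ∑ a', (∑ b', β x y a' b' * (Pi.single b 1 : B → ℝ) b'
          - ∑ b', β x y a' b' * (Pi.single b₀ 1 : B → ℝ) b') *
          (Pi.single a 1 - Pi.single a₀ 1 : A → ℝ) a' := by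
        simp only [← Finset.sum_sub_distrib, Finset.mul_sum, Finset.sum_mul]
        refine Finset.sum_congr rfl fun a' _ => Finset.sum_congr rfl fun b' _ => ?_
        simp only [correlationTable, Pi.smul_apply, smul_eq_mul, Pi.sub_apply]
        ring
    _ = _ := by
        simp only [h', Pi.sub_apply, mul_sub, Finset.sum_sub_distrib, sub_mul]
        rw [h, h, h, h]
        ring

/-- Product correlations between two outcomes of each party have Bell value at most `4`. -/
theorem abs_bellValue_correlationTable_mul_le {β : Table X Y A B} (hβ : IsNormalizedBell β)
    (a a₀ : A) (b b₀ : B) {r : X → ℝ} {s : Y → ℝ} (hr : ∀ x, |r x| ≤ 1) (hs : ∀ y, |s y| ≤ 1) :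
    |bellValue β (correlationTable a a₀ b b₀ fun x y => r x * s y)| ≤ 4 := by
  classical
  -- Each factor is a difference of probability vectors of opposite bias, so the table is a signed
  -- sum of four local products.
  have e : (correlationTable a a₀ b b₀ fun x y => r x * s y : Table X Y A B) =
      productTable ((fun x => twoPoint a a₀ (r x)) - fun x => twoPoint a a₀ (-r x))
        ((fun y => twoPoint b b₀ (s y)) - fun y => twoPoint b b₀ (-s y)) := by
    ext x y a' b'
    have h1 := congrFun (twoPoint_sub a a₀ (r x)) a'
    have h2 := congrFun (twoPoint_sub b b₀ (s y)) b'
    simp only [Pi.sub_apply, Pi.smul_apply, smul_eq_mul] at h1 h2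
    simp only [correlationTable, productTable, Pi.sub_apply, Pi.smul_apply, smul_eq_mul, h1, h2]
    ring
  have hr' : ∀ x, |-r x| ≤ 1 := fun x => by rw [abs_neg]; exact hr x
  have hs' : ∀ y, |-s y| ≤ 1 := fun y => by rw [abs_neg]; exact hs y
  have mem : ∀ {r : X → ℝ} {s : Y → ℝ}, (∀ x, |r x| ≤ 1) → (∀ y, |s y| ≤ 1) →
      |bellValue β (productTable (fun x => twoPoint a a₀ (r x)) fun y => twoPoint b b₀ (s y))|
        ≤ 1 := fun hr hs => hβ _ (productTable_mem_localDistributions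
          (fun x => twoPoint_mem_stdSimplex a a₀ (hr x))
          fun y => twoPoint_mem_stdSimplex b b₀ (hs y))
  rw [e, productTable_sub_left, productTable_sub_right, productTable_sub_right, bellValue_sub,
    bellValue_sub, bellValue_sub, abs_le]
  have h1 := abs_le.1 (mem hr hs)
  have h2 := abs_le.1 (mem hr hs')
  have h3 := abs_le.1 (mem hr' hs)
  have h4 := abs_le.1 (mem hr' hs')
  constructor <;> linarith

end Local

-- Grothendieck's constant for vectors of an arbitrary real inner product space.

section Correlations

variable {X Y : Type*} [Fintype X] [Fintype Y]

/-- The correlations that a Bell functional sees are those of unit vectors of a real inner product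
space, to which the Grothendieck constant applies. -/
theorem abs_sum_inner_le_grothendieckConstant {M : X → Y → ℝ}
    (hM : ∀ (s : X → ℝ) (t : Y → ℝ), (∀ x, |s x| ≤ 1) → (∀ y, |t y| ≤ 1) →
      |∑ x, ∑ y, M x y * (s x * t y)| ≤ 1)
    {H : Type*} [NormedAddCommGroup H] [InnerProductSpace ℝ H] (u : X → H) (v : Y → H)
    (hu : ∀ x, ‖u x‖ = 1) (hv : ∀ y, ‖v y‖ = 1) :
    |∑ x, ∑ y, M x y * inner ℝ (u x) (v y)| ≤ grothendieckConstant := by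
  let eX := (Fintype.equivFin X).symm
  let eY := (Fintype.equivFin Y).symm
  -- Finitely many vectors span a space isometric to some `ℝ^d`.
  let W : Submodule ℝ H := Submodule.span ℝ (Set.range u ∪ Set.range v)
  have : FiniteDimensional ℝ W :=
    FiniteDimensional.span_of_finite ℝ ((Set.finite_range u).union (Set.finite_range v))
  let u' : X → W := fun x => ⟨u x, Submodule.subset_span (.inl ⟨x, rfl⟩)⟩
  let v' : Y → W := fun y => ⟨v y, Submodule.subset_span (.inr ⟨y, rfl⟩)⟩
  let φ := (stdOrthonormalBasis ℝ W).repr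
  have abs_sign : ∀ {s : ℝ}, s = 1 ∨ s = -1 → |s| ≤ 1 := by rintro _ (rfl | rfl) <;> simp
  have reindex : ∀ F : X → Y → ℝ, ∑ i, ∑ j, F (eX i) (eY j) = ∑ x, ∑ y, F x y := fun F => by
    rw [← eX.sum_comp]
    exact Finset.sum_congr rfl fun i _ => eY.sum_comp _
  have h := isGrothendieckBound_grothendieckConstant _ _ (fun i j => M (eX i) (eY j))
    (fun s t hs ht => by
      have := hM (fun x => s (eX.symm x)) (fun y => t (eY.symm y)) (fun x => abs_sign (hs _))
        fun y => abs_sign (ht _)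
      rw [← reindex] at this
      simpa [mul_assoc] using this)
    _ (fun i => φ (u' (eX i))) (fun j => φ (v' (eY j)))
    (fun i => (φ.norm_map _).trans (hu _)) (fun j => (φ.norm_map _).trans (hv _))
  simp only [LinearIsometryEquiv.inner_map_map] at h
  rw [reindex fun x y => M x y * inner ℝ (u' x) (v' y)] at h
  exact h

end Correlations

-- Bell values of quantum distributions.

section Quantum

theorem IsProjectiveMeasurement.inner_apply_apply {H A : Type*} [NormedAddCommGroup H]
    [InnerProductSpace ℂ H] [CompleteSpace H] [Fintype A] {E : A → H →L[ℂ] H}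
    (hE : IsProjectiveMeasurement E) (a : A) (φ χ : H) :
    inner ℂ (E a φ) χ = inner ℂ φ (E a χ) := (hE.selfAdjoint a).isSymmetric φ χ

/-- For a projection `E a`, the operator `2 E a - 1` is a self-adjoint unitary. -/
theorem IsProjectiveMeasurement.norm_two_smul_sub {H A : Type*} [NormedAddCommGroup H]
    [InnerProductSpace ℂ H] [CompleteSpace H] [Fintype A] {E : A → H →L[ℂ] H}
    (hE : IsProjectiveMeasurement E) (a : A) (ψ : H) :
    ‖(2 : ℂ) • E a ψ - ψ‖ = ‖ψ‖ := by
  have hid : E a (E a ψ) = E a ψ := congrArg (· ψ) (hE.idempotent a)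
  have h : inner ℂ ((2 : ℂ) • E a ψ - ψ) ((2 : ℂ) • E a ψ - ψ) = inner ℂ ψ ψ := by
    have h1 : inner ℂ (E a ψ) (E a ψ) = inner ℂ ψ (E a ψ) := by
      rw [hE.inner_apply_apply, hid]
    have h2 : inner ℂ (E a ψ) ψ = inner ℂ ψ (E a ψ) := hE.inner_apply_apply a ψ ψ
    simp only [inner_sub_left, inner_sub_right, inner_smul_left, inner_smul_right, h1, h2,
      map_ofNat]
    ring
  rw [inner_self_eq_norm_sq_to_K, inner_self_eq_norm_sq_to_K] at h
  have h' : ‖(2 : ℂ) • E a ψ - ψ‖ ^ 2 = ‖ψ‖ ^ 2 := by exact_mod_cast h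
  exact (sq_eq_sq₀ (norm_nonneg _) (norm_nonneg _)).1 h'

/-- The outcome probabilities of a projective measurement. -/
noncomputable def outcomeProb {H A : Type*} [NormedAddCommGroup H] [InnerProductSpace ℂ H]
    (E : A → H →L[ℂ] H) (ψ : H) (a : A) : ℝ := (inner ℂ ψ (E a ψ)).re

theorem IsProjectiveMeasurement.outcomeProb_mem_stdSimplex {H A : Type*} [NormedAddCommGroup H]
    [InnerProductSpace ℂ H] [CompleteSpace H] [Fintype A] {E : A → H →L[ℂ] H}
    (hE : IsProjectiveMeasurement E) {ψ : H} (hψ : ‖ψ‖ = 1) :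
    outcomeProb E ψ ∈ stdSimplex ℝ A := by
  refine ⟨fun a => ?_, ?_⟩
  · have hid : E a (E a ψ) = E a ψ := congrArg (· ψ) (hE.idempotent a)
    rw [outcomeProb, ← hid, ← hE.inner_apply_apply]
    exact inner_self_nonneg (𝕜 := ℂ)
  · unfold outcomeProb
    rw [← Complex.re_sum, ← inner_sum, ← sum_apply, hE.sum_eq_one]
    simp [hψ]

variable {X Y A B : Type*} [Fintype X] [Fintype Y] [Fintype A] [Fintype B]

/-- A table with vanishing marginals is a sum of correlation tables, as seen by a functional. -/
theorem bellValue_eq_sum_correlationTable (a₀ : A) (b₀ : B) {D : Table X Y A B}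
    (hA : ∀ x y b, ∑ a, D x y a b = 0) (hB : ∀ x y a, ∑ b, D x y a b = 0) (β : Table X Y A B) :
    bellValue β D =
      ∑ a, ∑ b, bellValue β (correlationTable a a₀ b b₀ fun x y => D x y a b) := by
  simp only [bellValue_correlationTable]
  have e : ∑ a, ∑ b, ∑ x, ∑ y,
      (β x y a b - β x y a₀ b - β x y a b₀ + β x y a₀ b₀) * D x y a b = ∑ x, ∑ y, ∑ a, ∑ b,
      (β x y a b - β x y a₀ b - β x y a b₀ + β x y a₀ b₀) * D x y a b := by
    simp only [Finset.sum_comm (s := (Finset.univ : Finset B)) (t := (Finset.univ : Finset X)),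
      Finset.sum_comm (s := (Finset.univ : Finset B)) (t := (Finset.univ : Finset Y))]
    rw [Finset.sum_comm]
    exact Finset.sum_congr rfl fun x _ => Finset.sum_comm
  rw [e]
  refine Finset.sum_congr rfl fun x _ => Finset.sum_congr rfl fun y _ => ?_
  -- Each coefficient involving `a₀` or `b₀` is constant in `a` or in `b`, so it meets a vanishing
  -- marginal of `D`.
  simp only [add_mul, sub_mul, Finset.sum_add_distrib, Finset.sum_sub_distrib, ← Finset.mul_sum,
    hB, mul_zero, Finset.sum_const_zero]
  rw [Finset.sum_comm (f := fun a b => β x y a₀ b * D x y a b)]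
  simp [← Finset.mul_sum, hA]

/-- The value of a normalized Bell functional at a quantum distribution. -/
theorem IsQuantum.bellValue_le [Nonempty A] [Nonempty B] {p : Table X Y A B}
    (hp : IsQuantum.{w} p) {β : Table X Y A B} (hβ : IsNormalizedBell β) :
    bellValue β p ≤
      1 + ((Fintype.card A : ℝ) - 1) * ((Fintype.card B : ℝ) - 1) * (grothendieckConstant + 1) := by
  classical
  obtain ⟨H, _, _, _, ψ, E, F, hψ, hE, hF, -, hpEF⟩ := hp
  obtain ⟨a₀⟩ := ‹Nonempty A›
  obtain ⟨b₀⟩ := ‹Nonempty B›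
  let α : X → A → ℝ := fun x => outcomeProb (E x) ψ
  let γ : Y → B → ℝ := fun y => outcomeProb (F y) ψ
  have hα : ∀ x, α x ∈ stdSimplex ℝ A := fun x => (hE x).outcomeProb_mem_stdSimplex hψ
  have hγ : ∀ y, γ y ∈ stdSimplex ℝ B := fun y => (hF y).outcomeProb_mem_stdSimplex hψ
  have hp' : ∀ x y a b, p x y a b = (inner ℂ ψ ((E x a * F y b) ψ)).re := fun x y a b => by
    rw [← hpEF, Complex.ofReal_re]
  have hsumB : ∀ x y a, ∑ b, p x y a b = α x a := fun x y a => by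
    simp only [hp', α, outcomeProb]
    rw [← Complex.re_sum, ← inner_sum, ← sum_apply, ← Finset.mul_sum,
      (hF y).sum_eq_one, mul_one]
  have hsumA : ∀ x y b, ∑ a, p x y a b = γ y b := fun x y b => by
    simp only [hp', γ, outcomeProb]
    rw [← Complex.re_sum, ← inner_sum, ← sum_apply, ← Finset.sum_mul,
      (hE x).sum_eq_one, one_mul]
  let P : Table X Y A B := productTable α γ
  let D : Table X Y A B := p - P
  have hD : bellValue β D = ∑ a, ∑ b,
      bellValue β (correlationTable a a₀ b b₀ fun x y => D x y a b) := by
    refine bellValue_eq_sum_correlationTable a₀ b₀ (fun x y b => ?_) (fun x y a => ?_) β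
    · simp only [D, P, productTable, Pi.sub_apply, Finset.sum_sub_distrib, ← Finset.sum_mul,
        (hα x).2, hsumA, one_mul, sub_self]
    · simp only [D, P, productTable, Pi.sub_apply, Finset.sum_sub_distrib, ← Finset.mul_sum,
        (hγ y).2, hsumB, mul_one, sub_self]
  have hterm : ∀ a b, bellValue β (correlationTable a a₀ b b₀ fun x y => D x y a b) ≤
      grothendieckConstant + 1 := by
    intro a b
    -- The real inner product is the real part of the complex one.
    let : InnerProductSpace ℝ H := InnerProductSpace.rclikeToReal ℂ H
    let u : X → H := fun x => (2 : ℂ) • E x a ψ - ψ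
    let v : Y → H := fun y => (2 : ℂ) • F y b ψ - ψ
    let M : X → Y → ℝ := fun x y =>
      (β x y a b - β x y a₀ b - β x y a b₀ + β x y a₀ b₀) / 4
    have hM : ∀ c : X → Y → ℝ, bellValue β (correlationTable a a₀ b b₀ c) =
        4 * ∑ x, ∑ y, M x y * c x y := fun c => by
      rw [bellValue_correlationTable]
      simp only [Finset.mul_sum, M]
      exact Finset.sum_congr rfl fun x _ => Finset.sum_congr rfl fun y _ => by ring
    have hMle : ∀ (s : X → ℝ) (t : Y → ℝ), (∀ x, |s x| ≤ 1) → (∀ y, |t y| ≤ 1) →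
        |∑ x, ∑ y, M x y * (s x * t y)| ≤ 1 := fun s t hs ht => by
      have h := abs_bellValue_correlationTable_mul_le hβ a a₀ b b₀ hs ht
      rw [hM, abs_mul, abs_of_pos (by norm_num : (0 : ℝ) < 4)] at h
      linarith
    have hK := abs_sum_inner_le_grothendieckConstant hMle u v
      (fun x => ((hE x).norm_two_smul_sub a ψ).trans hψ)
      (fun y => ((hF y).norm_two_smul_sub b ψ).trans hψ)
    -- The biases of the marginals lie in `[-1, 1]`; this is the source of the `+ 1` in `K_G + 1`.
    have h1 := hMle (fun x => 2 * α x a - 1) (fun y => 2 * γ y b - 1)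
      (fun x => abs_two_mul_sub_one_le (hα x) a) fun y => abs_two_mul_sub_one_le (hγ y) b
    have hinner : ∀ x y, inner ℝ (u x) (v y) =
        4 * p x y a b - 2 * α x a - 2 * γ y b + 1 := fun x y => by
      have e : inner ℂ (u x) (v y) = 4 * inner ℂ ψ ((E x a * F y b) ψ)
          - 2 * inner ℂ ψ (E x a ψ) - 2 * inner ℂ ψ (F y b ψ) + inner ℂ ψ ψ := by
        simp only [u, v, inner_sub_left, inner_sub_right, inner_smul_left, inner_smul_right,
          (hE x).inner_apply_apply, map_ofNat, mul_apply_eq_comp]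
        ring
      rw [real_inner_eq_re_inner ℂ, e, hp']
      simp [α, γ, outcomeProb, hψ]
    have hDM : ∑ x, ∑ y, M x y * D x y a b =
        (∑ x, ∑ y, M x y * inner ℝ (u x) (v y) -
          ∑ x, ∑ y, M x y * ((2 * α x a - 1) * (2 * γ y b - 1))) / 4 := by
      simp only [← Finset.sum_sub_distrib, Finset.sum_div, hinner]
      refine Finset.sum_congr rfl fun x _ => Finset.sum_congr rfl fun y _ => ?_
      simp only [D, P, productTable, Pi.sub_apply]
      ring
    rw [hM, hDM]
    have := (abs_le.1 hK).2
    have := (abs_le.1 h1).1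
    linarith
  have hsum : bellValue β D ≤
      ((Fintype.card A : ℝ) - 1) * ((Fintype.card B : ℝ) - 1) * (grothendieckConstant + 1) := by
    have hzero : ∀ c : X → Y → ℝ, ∀ a b, a = a₀ ∨ b = b₀ →
        bellValue β (correlationTable a a₀ b b₀ c) = 0 := by
      rintro c a b (rfl | rfl)
      · rw [correlationTable_self_left]; simp [bellValue]
      · rw [correlationTable_self_right]; simp [bellValue]
    rw [hD, ← Finset.add_sum_erase _ _ (Finset.mem_univ a₀)]
    rw [Finset.sum_eq_zero fun b _ => hzero _ _ _ (.inl rfl), zero_add]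
    have hinner : ∀ a ∈ Finset.univ.erase a₀,
        ∑ b, bellValue β (correlationTable a a₀ b b₀ fun x y => D x y a b) ≤
          ((Fintype.card B : ℝ) - 1) * (grothendieckConstant + 1) := fun a _ => by
      rw [← Finset.add_sum_erase _ _ (Finset.mem_univ b₀), hzero _ _ _ (.inr rfl), zero_add]
      refine (Finset.sum_le_card_nsmul _ _ _ fun b _ => hterm a b).trans_eq ?_
      rw [nsmul_eq_mul, Finset.cast_card_erase_of_mem (Finset.mem_univ _), Finset.card_univ]
    refine (Finset.sum_le_card_nsmul _ _ _ hinner).trans_eq ?_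
    rw [nsmul_eq_mul, Finset.cast_card_erase_of_mem (Finset.mem_univ _), Finset.card_univ,
      mul_assoc]
  have hP := (abs_le.1 (hβ P (productTable_mem_localDistributions hα hγ))).2
  have : bellValue β p = bellValue β P + bellValue β D := by
    rw [← bellValue_add, add_sub_cancel]
  linarith

end Quantum

-- Linear programming duality for the cost.

section Duality

variable {X Y A B : Type*}

/-- The combination of the local deterministic distributions with coefficients `q`. -/
noncomputable def deterministicMix {ι : Type*} [Fintype ι] (v : ι → (X → A) × (Y → B)) :
    (ι → ℝ) →ₗ[ℝ] Table X Y A B :=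
  Fintype.linearCombination ℝ fun i => localDeterministic (v i).1 (v i).2

/-- The ball of radius `c` of the `ℓ¹` norm. -/
def l1Ball (ι : Type*) [Fintype ι] (c : ℝ) : Set (ι → ℝ) := {q | ∑ i, |q i| ≤ c}

theorem convex_l1Ball (ι : Type*) [Fintype ι] (c : ℝ) : Convex ℝ (l1Ball ι c) := by
  intro q hq r hr s t hs ht hst
  simp only [l1Ball, Set.mem_ofPred_eq] at hq hr ⊢
  calc ∑ i, |(s • q + t • r) i| ≤ ∑ i, (s * |q i| + t * |r i|) :=
        Finset.sum_le_sum fun i _ => by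
          refine (abs_add_le _ _).trans_eq ?_
          simp [abs_mul, abs_of_nonneg hs, abs_of_nonneg ht]
    _ = s * ∑ i, |q i| + t * ∑ i, |r i| := by
        rw [Finset.sum_add_distrib, Finset.mul_sum, Finset.mul_sum]
    _ ≤ s * c + t * c := by gcongr
    _ = c := by rw [← add_mul, hst, one_mul]

theorem isCompact_l1Ball (ι : Type*) [Fintype ι] (c : ℝ) : IsCompact (l1Ball ι c) := by
  refine Metric.isCompact_of_isClosed_isBounded ?_ ?_
  · exact isClosed_le (by fun_prop) continuous_const
  · refine (Metric.isBounded_closedBall (x := (0 : ι → ℝ)) (r := c)).subset fun q hq => ?_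
    have hc : 0 ≤ c := (Finset.sum_nonneg fun _ _ => abs_nonneg _).trans hq
    rw [mem_closedBall_zero_iff, pi_norm_le_iff_of_nonneg hc]
    intro i
    exact (Finset.single_le_sum (f := fun i => |q i|) (fun _ _ => abs_nonneg _)
      (Finset.mem_univ i)).trans hq

theorem sum_abs_mem_affineModelCosts {n : ℕ} (v : Fin n ≃ (X → A) × (Y → B)) (q : Fin n → ℝ) :
    ∑ i, |q i| ∈ affineModelCosts (deterministicMix v q) :=
  ⟨n, q, fun i => localDeterministic (v i).1 (v i).2,
    fun i => subset_convexHull _ _ ⟨_, _, rfl⟩, by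
      simp [deterministicMix, Fintype.linearCombination_apply], rfl⟩

/-- Expanding each local distribution into deterministic ones does not increase the cost, so a fixed
finite-dimensional coefficient space suffices. -/
theorem exists_l1Ball_of_mem_affineModelCosts {ι : Type*} [Fintype ι]
    (v : ι ≃ (X → A) × (Y → B)) {p : Table X Y A B} {c : ℝ} (hc : c ∈ affineModelCosts p) :
    ∃ q ∈ l1Ball ι c, deterministicMix v q = p := by
  classical
  obtain ⟨n, q, P, hP, rfl, rfl⟩ := hc
  have hloc : localDistributions X Y A B ⊆ deterministicMix v '' l1Ball ι 1 := by
    refine convexHull_min ?_ ((convex_l1Ball ι 1).linear_image (deterministicMix v))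
    rintro _ ⟨f, g, rfl⟩
    refine ⟨Pi.single (v.symm (f, g)) 1, ?_, ?_⟩
    · simp only [l1Ball, Set.mem_ofPred_eq]
      rw [Finset.sum_eq_single (v.symm (f, g))] <;> simp +contextual
    · simp [deterministicMix, Fintype.linearCombination_apply_single]
  choose r hr hrP using fun i => hloc (hP i)
  refine ⟨∑ i, q i • r i, ?_, by simp [map_sum, hrP]⟩
  calc ∑ k, |(∑ i, q i • r i) k| ≤ ∑ k, ∑ i, |q i| * |r i k| := Finset.sum_le_sum fun k _ => by
        rw [Finset.sum_apply]
        refine (Finset.abs_sum_le_sum_abs _ _).trans_eq ?_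
        simp [abs_mul]
    _ = ∑ i, |q i| * ∑ k, |r i k| := by
        rw [Finset.sum_comm]; simp only [Finset.mul_sum]
    _ ≤ ∑ i, |q i| := Finset.sum_le_sum fun i _ =>
        mul_le_of_le_one_right (abs_nonneg _) (hr i)

variable [Fintype X] [Fintype Y] [Fintype A] [Fintype B]

theorem exists_bellValue_eq (f : Table X Y A B →ₗ[ℝ] ℝ) :
    ∃ β : Table X Y A B, ∀ p, bellValue β p = f p := by
  classical
  refine ⟨fun x y a b => f (Pi.single x (Pi.single y (Pi.single a (Pi.single b 1)))), fun p => ?_⟩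
  have h : p = ∑ x, ∑ y, ∑ a, ∑ b,
      p x y a b • Pi.single x (Pi.single y (Pi.single a (Pi.single b (1 : ℝ)))) := by
    ext x y a b
    simp [Finset.sum_apply, Pi.single_apply, ite_apply]
  conv_rhs => rw [h]
  simp [bellValue, map_sum, mul_comm]

theorem isNormalizedBell_of_deterministic {β : Table X Y A B}
    (h : ∀ f g, |bellValue β (localDeterministic f g)| ≤ 1) : IsNormalizedBell β := by
  have hconv : Convex ℝ {p : Table X Y A B | |bellValue β p| ≤ 1} := by
    intro p hp q hq s t hs ht hst
    simp only [Set.mem_ofPred_eq, bellValue_add, bellValue_smul, abs_le] at hp hq ⊢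
    constructor <;> nlinarith
  refine fun p hp => convexHull_min ?_ hconv hp
  rintro _ ⟨f, g, rfl⟩
  exact h f g

/-- Linear programming duality for the cost of a model of `p`. -/
theorem exists_mem_l1Ball_of_bellValue_le {ι : Type*} [Fintype ι] (v : ι ≃ (X → A) × (Y → B))
    {p : Table X Y A B} {c : ℝ} (hc : 0 < c)
    (h : ∀ β : Table X Y A B, IsNormalizedBell β → bellValue β p ≤ c) :
    ∃ q ∈ l1Ball ι c, deterministicMix v q = p := by
  classical
  by_contra hne
  have hcpt : IsCompact (deterministicMix v '' l1Ball ι c) :=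
    (isCompact_l1Ball ι c).image (LinearMap.continuous_of_finiteDimensional _)
  obtain ⟨f, r, hfr, hr⟩ := geometric_hahn_banach_closed_point
    ((convex_l1Ball ι c).linear_image (deterministicMix v)) hcpt.isClosed hne
  have hr0 : 0 < r := by
    have := hfr 0 ⟨0, by simp [l1Ball, hc.le], map_zero _⟩
    simpa using this
  -- Scaled so that the separating level `r` becomes `c`: the points `±c` times a deterministic
  -- table give normalization, while `p` gets a value above `c`.
  obtain ⟨β, hβ⟩ := exists_bellValue_eq ((c / r) • (f : Table X Y A B →ₗ[ℝ] ℝ))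
  have hval : ∀ p, bellValue β p = c / r * f p := fun p => by simpa using hβ p
  have hnorm : IsNormalizedBell β := by
    refine isNormalizedBell_of_deterministic fun g g' => ?_
    have key : ∀ t : ℝ, |t| = c → t * f (localDeterministic g g') < r := fun t ht => by
      have := hfr (deterministicMix v (Pi.single (v.symm (g, g')) t))
        ⟨_, by
          simp only [l1Ball, Set.mem_ofPred_eq]
          rw [Finset.sum_eq_single (v.symm (g, g'))] <;> simp +contextual [ht], rfl⟩
      simpa [deterministicMix, Fintype.linearCombination_apply_single] using this
    have h1 := key c (abs_of_pos hc)
    have h2 := key (-c) (by rw [abs_neg, abs_of_pos hc])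
    rw [hval, div_mul_eq_mul_div, abs_le, le_div_iff₀ hr0, div_le_iff₀ hr0]
    constructor <;> linarith
  have := h β hnorm
  rw [hval, div_mul_eq_mul_div, div_le_iff₀ hr0] at this
  exact absurd (le_of_mul_le_mul_left this hc) (not_le.2 hr)

/-- Duality for `ν̃`: the minimum exists and is bounded by any positive bound on the values of the
normalized Bell functionals. -/
theorem isLeast_nuTilde_and_le {p : Table X Y A B} {c : ℝ} (hc : 0 < c)
    (h : ∀ β : Table X Y A B, IsNormalizedBell β → bellValue β p ≤ c) :
    IsLeast (affineModelCosts p) (nuTilde p) ∧ nuTilde p ≤ c := by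
  classical
  let v := (Fintype.equivFin ((X → A) × (Y → B))).symm
  obtain ⟨q₀, hq₀, hq₀p⟩ := exists_mem_l1Ball_of_bellValue_le v hc h
  have hcpt : IsCompact (l1Ball _ c ∩ {q | deterministicMix v q = p}) :=
    (isCompact_l1Ball _ c).inter_right
      (isClosed_eq (LinearMap.continuous_of_finiteDimensional _) continuous_const)
  obtain ⟨q, ⟨hq, hqp⟩, hmin⟩ := hcpt.exists_isMinOn ⟨q₀, hq₀, hq₀p⟩
    (f := fun q => ∑ i, |q i|) (by fun_prop)
  have hleast : IsLeast (affineModelCosts p) (∑ i, |q i|) := by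
    refine ⟨hqp ▸ sum_abs_mem_affineModelCosts v q, fun c' hc' => ?_⟩
    obtain ⟨r, hr, hrp⟩ := exists_l1Ball_of_mem_affineModelCosts v hc'
    -- Costs above `c` cannot beat `q`; cheaper models lie in the compact set where `q` is minimal.
    rcases le_total c c' with hcc | hcc
    · exact le_trans hq hcc
    · exact (hmin ⟨le_trans hr hcc, hrp⟩).trans hr
  have heq : nuTilde p = ∑ i, |q i| := hleast.csInf_eq
  rw [heq]
  exact ⟨hleast, hq⟩

end Duality

end BellScenario

theorem mainTheorem5 {X Y A B : Type*}
    [Fintype X] [Fintype Y] [Fintype A] [Fintype B] [Nonempty A] [Nonempty B]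
    (p : BellScenario.Table X Y A B) (hp : BellScenario.IsQuantum.{w} p) :
    -- the minimum defining `ν̃(p)` exists
    IsLeast (BellScenario.affineModelCosts p) (BellScenario.nuTilde p) ∧
    -- binary outcomes
    (Fintype.card A = 2 → Fintype.card B = 2 →
      BellScenario.nuTilde p ≤ 2 * BellScenario.grothendieckConstant + 1 ∧
      ∀ β : BellScenario.Table X Y A B, BellScenario.IsNormalizedBell β →
        BellScenario.bellValue β p ≤ 2 * BellScenario.grothendieckConstant + 1) ∧
    -- arbitrary outcomes
    (BellScenario.nuTilde p ≤
        2 * (Fintype.card A : ℝ) * (Fintype.card B : ℝ) *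
          (BellScenario.grothendieckConstant + 1) - 1 ∧
      ∀ β : BellScenario.Table X Y A B, BellScenario.IsNormalizedBell β →
        BellScenario.bellValue β p ≤
          2 * (Fintype.card A : ℝ) * (Fintype.card B : ℝ) *
            (BellScenario.grothendieckConstant + 1) - 1) := by
  have hK := BellScenario.one_le_grothendieckConstant
  have hA : (1 : ℝ) ≤ Fintype.card A := by exact_mod_cast Fintype.card_pos (α := A)
  have hB : (1 : ℝ) ≤ Fintype.card B := by exact_mod_cast Fintype.card_pos (α := B)
  have hβ := fun (β : BellScenario.Table X Y A B) (h : BellScenario.IsNormalizedBell β) =>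
    hp.bellValue_le h
  set K := BellScenario.grothendieckConstant
  have hAB : 0 ≤ ((Fintype.card A : ℝ) - 1) * ((Fintype.card B : ℝ) - 1) :=
    mul_nonneg (by linarith) (by linarith)
  have hpos : 0 < 1 + ((Fintype.card A : ℝ) - 1) * ((Fintype.card B : ℝ) - 1) * (K + 1) := by
    have := mul_nonneg hAB (by linarith : 0 ≤ K + 1)
    linarith
  obtain ⟨hleast, hnu⟩ := BellScenario.isLeast_nuTilde_and_le hpos hβ
  have hgen : 1 + ((Fintype.card A : ℝ) - 1) * ((Fintype.card B : ℝ) - 1) * (K + 1) ≤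
      2 * (Fintype.card A : ℝ) * (Fintype.card B : ℝ) * (K + 1) - 1 := by
    -- A gap of 1 suffices, since it is multiplied by `K + 1 ≥ 2`.
    have h : 1 ≤ 2 * (Fintype.card A : ℝ) * (Fintype.card B : ℝ)
        - ((Fintype.card A : ℝ) - 1) * ((Fintype.card B : ℝ) - 1) := by nlinarith
    nlinarith
  refine ⟨hleast, fun h2A h2B => ?_, hnu.trans hgen, fun β h => (hβ β h).trans hgen⟩
  -- Here the left side is `K + 2`, and `1 ≤ K` is exactly what is needed.
  have hbin : 1 + ((Fintype.card A : ℝ) - 1) * ((Fintype.card B : ℝ) - 1) * (K + 1) ≤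
      2 * K + 1 := by
    rw [h2A, h2B]; norm_num; linarith
  exact ⟨hnu.trans hbin, fun β h => (hβ β h).trans hbin⟩
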